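/- Let $(Y,C,W,Z)$ be real random variables following the partly linear normal model with current status data at the true parameters $(\theta_0,k_0)$: $Y=\theta_0W+k_0(Z)+\xi$, where $\xi\sim N(0,1)$ is independent of $(W,Z)$; $Y$ and $C$ are conditionally independent given $(W,Z)$; $C$ takes values in a bounded interval $[l_c,u_c]$, $W$ in a compact set $\mathcal W\subset\mathbb R$ and $Z$ in a compact interval $\mathcal Z=[a,b]$ with $a<b$, almost surely; and $E[\operatorname{Var}(W\mid Z)]>0$. The observation is $X=(C,\Delta,W,Z)$ with $\Delta=1_{\{Y\le C\}}$, and $X_1,X_2,\dots$ are i.i.d. copies of $X$. The parameter $\theta$ ranges over a compact set $\Theta\subset\mathbb R$ with $\theta_0\in\Theta$, and $k$ ranges over a class $\mathcal H\ni k_0$, which is either $$\mathcal O_2^M=\{f:J_2(f)+\|f\|_\infty<M\},\qquad J_2(f)=\Big(\int_a^b f''(z)^2\,dz\Big)^{1/2},\qquad \|f\|_\infty=\sup_{z\in[a,b]}|f(z)|,$$ where $M<\infty$ is known and $f$ ranges over the second-order Sobolev functions on $[a,b]$ ($f$ is $C^1$, $f'$ is absolutely continuous, and $f''\in L_2[a,b]$),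 or its subset of those $k$ with $E\,k(Z)=0$. With $\Phi$ the standard normal distribution function, put $$\log \mathrm{lik}_{\theta,k}(c,\delta,w,z)=\delta\log\Phi(c-\theta w-k(z))+(1-\delta)\log\{1-\Phi(c-\theta w-k(z))\},$$ $$pl_n(\theta)=\sup_{k\in\mathcal H}\prod_{i=1}^n \mathrm{lik}_{\theta,k}(X_i),\qquad \Delta_n(\theta)=n^{-1}\{\log pl_n(\theta)-\log pl_n(\hat\theta_n)\},$$ where $\hat\theta_n\in\Theta$ maximizes $pl_n$ over $\Theta$ (almost surely, for each $n$). Then, for every sequence $\tilde\theta_n$ of random elements of $\Theta$, $\Delta_n(\tilde\theta_n)=o_P(1)$ implies $\tilde\theta_n=\theta_0+o_P(1)$. (If $\tilde\theta_n$ or $\hat\theta_n$ is not measurable, $o_P$ is understood in outer probability.) -/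

import Mathlib

open MeasureTheory ProbabilityTheory Filter Topology Set

noncomputable section

namespace PartlyLinear

/-- The uniform norm of `f` on the interval `[a, b]`. -/
def supNorm (a b : ℝ) (f : ℝ → ℝ) : ℝ := ⨆ z : Icc a b, |f z|

/-- `f` belongs to the second-order Sobolev space on `[a, b]`: it is continuously differentiable,
its derivative is absolutely continuous (so that the second derivative exists almost everywhere),
and its second derivative is square integrable. -/
structure IsSobolev (a b : ℝ) (f : ℝ → ℝ) : Prop where
  contDiffOn : ContDiffOn ℝ 1 f (Icc a b)
  absolutelyContinuous : AbsolutelyContinuousOnInterval (derivWithin f (Icc a b)) a b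
  integrable_sq : IntegrableOn (fun z => iteratedDerivWithin 2 f (Icc a b) z ^ 2) (Icc a b)

/-- The Sobolev (semi)norm `J₂(f) = (∫ₐᵇ f''(z)² dz)^(1/2)`. -/
def sobolevJ (a b : ℝ) (f : ℝ → ℝ) : ℝ :=
  √(∫ z in Icc a b, iteratedDerivWithin 2 f (Icc a b) z ^ 2)

/-- The class of all `f` on `[a, b]` with `J₂(f) + ‖f‖_∞ < M`. Only the values of `f` on `[a, b]`
matter. -/
def nuisanceClass (a b M : ℝ) : Set (ℝ → ℝ) :=
  {f | IsSobolev a b f ∧ sobolevJ a b f + supNorm a b f < M}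

/-- The standard normal distribution function. -/
def Phi (x : ℝ) : ℝ := cdf (gaussianReal 0 1) x

/-- The log-likelihood of one observation `x = (c, δ, w, z)`. -/
def logLik (θ : ℝ) (k : ℝ → ℝ) : ℝ × ℝ × ℝ × ℝ → ℝ := fun (c, δ, w, z) =>
  δ * Real.log (Phi (c - θ * w - k z)) + (1 - δ) * Real.log (1 - Phi (c - θ * w - k z))

variable {Ω Ω₀ : Type*}

/-- The likelihood of the first `n` observations of the sample `X` at the outcome `ω`. -/
def likN (X : ℕ → Ω → ℝ × ℝ × ℝ × ℝ) (n : ℕ) (ω : Ω) (θ : ℝ) (k : ℝ → ℝ) : ℝ :=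
  Real.exp (∑ i ∈ Finset.range n, logLik θ k (X i ω))

/-- The profile likelihood `plₙ(θ) = sup_{k ∈ H} likₙ(θ, k)`. -/
def profileLik (H : Set (ℝ → ℝ)) (X : ℕ → Ω → ℝ × ℝ × ℝ × ℝ) (n : ℕ) (ω : Ω) (θ : ℝ) : ℝ :=
  ⨆ k : H, likN X n ω θ k

/-- `θhat` is a maximizer over `Θ` of the profile likelihood. -/
def IsProfileMLE (Θ : Set ℝ) (H : Set (ℝ → ℝ)) (X : ℕ → Ω → ℝ × ℝ × ℝ × ℝ) (n : ℕ) (ω : Ω)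
    (θhat : ℝ) : Prop :=
  θhat ∈ Θ ∧ IsMaxOn (profileLik H X n ω) Θ θhat

/-- `Δₙ(θ) = n⁻¹ (log plₙ(θ) - log plₙ(θhat))`. -/
def profileDelta (H : Set (ℝ → ℝ)) (X : ℕ → Ω → ℝ × ℝ × ℝ × ℝ) (n : ℕ) (ω : Ω)
    (θhat θ : ℝ) : ℝ :=
  (n : ℝ)⁻¹ * (Real.log (profileLik H X n ω θ) - Real.log (profileLik H X n ω θhat))

open Classical in
/-- The observable vector `(C, 1{Y ≤ C}, W, Z)`. -/
def observation (Y C W Z : Ω₀ → ℝ) (ω : Ω₀) : ℝ × ℝ × ℝ × ℝ :=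
  (C ω, if Y ω ≤ C ω then 1 else 0, W ω, Z ω)

/-- The partly linear normal model with parameters `θ₀`, `k₀` for the outcome `Y`, the censoring
time `C` and the covariates `W`, `Z`: given `(W, Z)`, the residual `Y - θ₀ W - k₀(Z)` is standard
normal, and `Y` and `C` are conditionally independent; `C` lies in `[lc, uc]` and `(W, Z)` in the
compact set `K × [a, b]`; and `E[Var(W | Z)] > 0`. -/
structure IsModel [MeasurableSpace Ω₀] [StandardBorelSpace Ω₀] (P : Measure Ω₀)
    [IsProbabilityMeasure P] (Y C W Z : Ω₀ → ℝ) (θ₀ : ℝ) (k₀ : ℝ → ℝ)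
    (lc uc : ℝ) (K : Set ℝ) (a b : ℝ) : Prop where
  measurable_Y : Measurable Y
  measurable_C : Measurable C
  measurable_W : Measurable W
  measurable_Z : Measurable Z
  residual_law : HasLaw (fun ω => Y ω - θ₀ * W ω - k₀ (Z ω)) (gaussianReal 0 1) P
  residual_indep :
    IndepFun (fun ω => Y ω - θ₀ * W ω - k₀ (Z ω)) (fun ω => (W ω, Z ω)) P
  condIndep :
    CondIndepFun (MeasurableSpace.comap (fun ω => (W ω, Z ω)) inferInstance)
      (measurable_W.prodMk measurable_Z).comap_le Y C P
  C_mem : ∀ᵐ ω ∂P, C ω ∈ Icc lc uc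
  W_mem : ∀ᵐ ω ∂P, W ω ∈ K
  Z_mem : ∀ᵐ ω ∂P, Z ω ∈ Icc a b
  condVar_pos : 0 < ∫ ω, condVar (MeasurableSpace.comap Z inferInstance) W P ω ∂P

end PartlyLinear

end

/-! This is Wald's consistency argument with `k` profiled out; two facts carry it. Separation
(`IsModel.exists_integral_logLik_le`): given (C, W, Z), the indicator is Bernoulli with parameter
Φ(C - θ₀W - k₀(Z)), so the loss in expected log-likelihood at (θ, k) is a mean Kullback–Leibler
divergence, at least half the mean squared difference of the two probabilities. The arguments of Φ
stay in a compact interval, where its slope is bounded below. Hence the loss is at least a constant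
times E[((θ - θ₀)W + (k - k₀)(Z))²], which is at least (θ - θ₀)² E[Var(W | Z)] whatever k is.
Uniformity (`exists_finite_cover`): the bound M makes the nuisance class bounded and equi-Lipschitz,
so by Arzelà–Ascoli finitely many log-likelihoods approximate all of them uniformly, and the law of
large numbers is needed only at these. Thus, with probability tending to one, the normalized profile
log-likelihood at every θ with |θ - θ₀| ≥ ε lies below that of the maximizer by a fixed margin,
which a small `profileDelta` excludes. -/

namespace PartlyLinear

/-! ### The standard normal distribution function -/

theorem Phi_eq_real (x : ℝ) : Phi x = (gaussianReal 0 1).real (Iic x) := cdf_eq_real _ x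

theorem monotone_Phi : Monotone Phi := monotone_cdf _

theorem Phi_sub_Phi {x y : ℝ} (h : x ≤ y) :
    Phi y - Phi x = ∫ t in Ioc x y, gaussianPDFReal 0 1 t := by
  have h1 : Phi y - Phi x = (gaussianReal 0 1).real (Ioc x y) := by
    rw [Phi_eq_real, Phi_eq_real, show Ioc x y = Iic y \ Iic x by ext; simp [and_comm],
      measureReal_sdiff (Iic_subset_Iic.2 h) measurableSet_Iic]
  rw [h1, measureReal_def, gaussianReal_apply_eq_integral _ one_ne_zero,
    ENNReal.toReal_ofReal (integral_nonneg fun t => gaussianPDFReal_nonneg _ _ _)]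

theorem gaussianPDFReal_le_one (t : ℝ) : gaussianPDFReal 0 1 t ≤ 1 := by
  rw [gaussianPDFReal_def]
  have h1 : (√(2 * Real.pi * (1 : NNReal)))⁻¹ ≤ 1 := by
    refine inv_le_one_of_one_le₀ (Real.one_le_sqrt.2 ?_)
    have := Real.pi_gt_three
    simp only [NNReal.coe_one]
    linarith
  have h2 : Real.exp (-(t - 0) ^ 2 / (2 * (1 : NNReal))) ≤ 1 := by
    rw [Real.exp_le_one_iff]
    simp only [NNReal.coe_one]
    nlinarith [sq_nonneg (t - 0)]
  exact mul_le_one₀ h1 (Real.exp_pos _).le h2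

theorem gaussianPDFReal_ge {R t : ℝ} (ht : |t| ≤ R) :
    gaussianPDFReal 0 1 R ≤ gaussianPDFReal 0 1 t := by
  simp only [gaussianPDFReal_def]
  have : t ^ 2 ≤ R ^ 2 := sq_le_sq' (neg_le_of_abs_le ht) (le_of_abs_le ht)
  gcongr 2
  rw [sub_zero, sub_zero]
  gcongr

theorem Phi_sub_Phi_le {x y : ℝ} (h : x ≤ y) : Phi y - Phi x ≤ y - x := by
  rw [Phi_sub_Phi h]
  calc _ ≤ ∫ t in Ioc x y, (1 : ℝ) :=
        setIntegral_mono (integrable_gaussianPDFReal _ _).integrableOn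
          (integrableOn_const (by simp)) gaussianPDFReal_le_one
    _ = y - x := by simp [h]

theorem le_Phi_sub_Phi {R x y : ℝ} (h : x ≤ y) (hx : -R ≤ x) (hy : y ≤ R) :
    gaussianPDFReal 0 1 R * (y - x) ≤ Phi y - Phi x := by
  rw [Phi_sub_Phi h]
  calc _ = ∫ t in Ioc x y, gaussianPDFReal 0 1 R := by simp [h, mul_comm]
    _ ≤ _ := setIntegral_mono_on (integrableOn_const (by simp))
        (integrable_gaussianPDFReal _ _).integrableOn measurableSet_Ioc
        fun t ht => gaussianPDFReal_ge (abs_le.2 ⟨by linarith [ht.1], by linarith [ht.2]⟩)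

/-- On [-R, R] the density is smallest at the endpoints. The bound turns a gap between probabilities
into a gap between indices. -/
theorem le_abs_Phi_sub_Phi {R x y : ℝ} (hx : |x| ≤ R) (hy : |y| ≤ R) :
    gaussianPDFReal 0 1 R * |y - x| ≤ |Phi y - Phi x| := by
  rw [abs_le] at hx hy
  rcases le_total x y with h | h
  · rw [abs_of_nonneg (sub_nonneg.2 h), abs_of_nonneg (sub_nonneg.2 (monotone_Phi h))]
    exact le_Phi_sub_Phi h hx.1 hy.2
  · rw [abs_sub_comm y, abs_sub_comm (Phi y), abs_of_nonneg (sub_nonneg.2 h),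
      abs_of_nonneg (sub_nonneg.2 (monotone_Phi h))]
    exact le_Phi_sub_Phi h hy.1 hx.2

theorem continuous_Phi : Continuous Phi := by
  refine LipschitzWith.continuous (K := 1) (LipschitzWith.of_dist_le_mul fun x y => ?_)
  rw [Real.dist_eq, Real.dist_eq, NNReal.coe_one, one_mul]
  rcases le_total x y with h | h
  · rw [abs_sub_comm, abs_sub_comm x, abs_of_nonneg (sub_nonneg.2 h),
      abs_of_nonneg (sub_nonneg.2 (monotone_Phi h))]
    exact Phi_sub_Phi_le h
  · rw [abs_of_nonneg (sub_nonneg.2 h), abs_of_nonneg (sub_nonneg.2 (monotone_Phi h))]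
    exact Phi_sub_Phi_le h

theorem strictMono_Phi : StrictMono Phi := fun x y h => by
  have h1 := le_Phi_sub_Phi (R := max |x| |y|) h.le
    (by linarith [neg_abs_le x, le_max_left |x| |y|])
    (by linarith [le_abs_self y, le_max_right |x| |y|])
  have h2 := gaussianPDFReal_pos 0 1 (max |x| |y|) one_ne_zero
  nlinarith [mul_pos h2 (sub_pos.2 h)]

theorem Phi_pos (x : ℝ) : 0 < Phi x :=
  (cdf_nonneg _ (x - 1)).trans_lt (strictMono_Phi (by linarith))

theorem Phi_lt_one (x : ℝ) : Phi x < 1 :=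
  (strictMono_Phi (by linarith : x < x + 1)).trans_le (cdf_le_one _ (x + 1))

theorem continuous_log_Phi : Continuous fun x => Real.log (Phi x) :=
  continuous_Phi.log fun x => (Phi_pos x).ne'

theorem continuous_log_one_sub_Phi : Continuous fun x => Real.log (1 - Phi x) :=
  (continuous_const.sub continuous_Phi).log fun x => (sub_pos.2 (Phi_lt_one x)).ne'

theorem logLik_nonpos (θ : ℝ) (k : ℝ → ℝ) (c δ w z : ℝ) (hδ : δ ∈ ({0, 1} : Set ℝ)) :
    logLik θ k (c, δ, w, z) ≤ 0 := by
  have h1 := Phi_pos (c - θ * w - k z)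
  have h2 := Phi_lt_one (c - θ * w - k z)
  rcases hδ with rfl | rfl
  · simpa [logLik] using Real.log_nonpos (by linarith) (by linarith)
  · simpa [logLik] using Real.log_nonpos (by linarith) (by linarith)

/-! ### Kullback–Leibler and Hellinger bounds for Bernoulli laws -/

/-- Apply log x ≤ x - 1 to x = √(q/p) rather than to q/p: this keeps a Hellinger term that is
quadratic in the difference. -/
theorem mul_log_div_le {p q : ℝ} (hp : 0 < p) (hq : 0 < q) :
    p * Real.log q - p * Real.log p ≤ 2 * (√p * √q) - 2 * p := by
  have h1 : Real.log (√q / √p) ≤ √q / √p - 1 :=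
    Real.log_le_sub_one_of_pos (div_pos (Real.sqrt_pos.2 hq) (Real.sqrt_pos.2 hp))
  rw [Real.log_div (Real.sqrt_pos.2 hq).ne' (Real.sqrt_pos.2 hp).ne', Real.log_sqrt hq.le,
    Real.log_sqrt hp.le] at h1
  have h2 : p * (√q / √p) = √p * √q := by
    have := (Real.sqrt_pos.2 hp).ne'
    nth_rw 1 [← Real.mul_self_sqrt hp.le]
    field_simp
  nlinarith [mul_le_mul_of_nonneg_left h1 hp.le]

/-- Factor p - q = (√p - √q)(√p + √q); the second factor is at most 2. -/
theorem sq_sub_le_of_sqrt {p q : ℝ} (hp : 0 ≤ p) (hq : 0 ≤ q) (hp1 : p ≤ 1) (hq1 : q ≤ 1) :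
    (p - q) ^ 2 ≤ 4 * (p + q - 2 * (√p * √q)) := by
  have h1 := Real.sq_sqrt hp
  have h2 := Real.sq_sqrt hq
  have h3 := Real.sqrt_nonneg p
  have h4 := Real.sqrt_nonneg q
  have h5 : √p ≤ 1 := Real.sqrt_le_one.2 hp1
  have h6 : √q ≤ 1 := Real.sqrt_le_one.2 hq1
  have h7 : p - q = (√p - √q) * (√p + √q) := by nlinarith
  have h8 : (√p + √q) ^ 2 ≤ 4 := by nlinarith
  have h9 : p + q - 2 * (√p * √q) = (√p - √q) ^ 2 := by nlinarith
  rw [h7, h9, mul_pow]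
  nlinarith [sq_nonneg (√p - √q)]

/-- The Kullback–Leibler divergence between two Bernoulli laws dominates the squared difference
of their parameters. -/
theorem bernoulli_log_le {p q : ℝ} (hp : 0 < p) (hp1 : p < 1) (hq : 0 < q) (hq1 : q < 1) :
    p * Real.log q + (1 - p) * Real.log (1 - q) ≤
      p * Real.log p + (1 - p) * Real.log (1 - p) - (p - q) ^ 2 / 2 := by
  -- The two right-hand sides add up to minus the squared Hellinger distance, since 2p + 2(1 - p) =
  -- (p + q) + (1 - p) + (1 - q); each half of it is at least (p - q)²/4.
  have h1 := mul_log_div_le hp hq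
  have h2 := mul_log_div_le (sub_pos.2 hp1) (sub_pos.2 hq1)
  have h3 := sq_sub_le_of_sqrt hp.le hq.le hp1.le hq1.le
  have h4 := sq_sub_le_of_sqrt (sub_pos.2 hp1).le (sub_pos.2 hq1).le (by linarith) (by linarith)
  nlinarith

/-! ### Compactness of the nuisance class and of the log-likelihoods -/

section Nuisance

variable {a b M : ℝ} {f : ℝ → ℝ}

theorem nuisanceClass.continuousOn (hf : f ∈ nuisanceClass a b M) : ContinuousOn f (Icc a b) :=
  hf.1.contDiffOn.continuousOn

theorem nuisanceClass.abs_le (hf : f ∈ nuisanceClass a b M) {z : ℝ} (hz : z ∈ Icc a b) :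
    |f z| ≤ M := by
  have h1 : BddAbove (range fun z : Icc a b => |f z|) := by
    have := isCompact_Icc.bddAbove_image (nuisanceClass.continuousOn hf).abs
    rwa [image_eq_range] at this
  have h2 : |f z| ≤ supNorm a b f := le_ciSup h1 ⟨z, hz⟩
  have h3 : 0 ≤ sobolevJ a b f := Real.sqrt_nonneg _
  linarith [hf.2]

theorem nuisanceClass.integral_abs_deriv_le (hab : a < b) (hf : f ∈ nuisanceClass a b M) :
    ∫ z in Icc a b, |deriv (derivWithin f (Icc a b)) z| ≤ (b - a + M ^ 2) / 2 := by
  set g := derivWithin f (Icc a b) with hg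
  -- The two second derivatives may differ at the endpoints, which form a null set.
  have heq : EqOn (fun z => iteratedDerivWithin 2 f (Icc a b) z ^ 2) (fun z => deriv g z ^ 2)
      (Ioo a b) := fun z hz => by
    simp only [iteratedDerivWithin_succ, iteratedDerivWithin_zero]
    rw [derivWithin_of_mem_nhds (Icc_mem_nhds hz.1 hz.2)]
  have hint : IntegrableOn (fun z => deriv g z ^ 2) (Icc a b) := by
    rw [integrableOn_Icc_iff_integrableOn_Ioo]
    exact (hf.1.integrable_sq.mono_set Ioo_subset_Icc_self).congr_fun heq measurableSet_Ioo
  have hJ : ∫ z in Icc a b, deriv g z ^ 2 ≤ M ^ 2 := by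
    have h1 : ∫ z in Icc a b, deriv g z ^ 2 = sobolevJ a b f ^ 2 := by
      rw [sobolevJ, Real.sq_sqrt (integral_nonneg fun z => sq_nonneg _),
        integral_Icc_eq_integral_Ioo, integral_Icc_eq_integral_Ioo]
      exact (setIntegral_congr_fun measurableSet_Ioo heq).symm
    have h2 : 0 ≤ sobolevJ a b f := Real.sqrt_nonneg _
    have h3 : 0 ≤ supNorm a b f := Real.iSup_nonneg fun _ => abs_nonneg _
    rw [h1]
    exact pow_le_pow_left₀ h2 (by linarith [hf.2]) 2
  have hac := hf.1.absolutelyContinuous.intervalIntegrable_deriv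
  rw [intervalIntegrable_iff_integrableOn_Icc_of_le hab.le] at hac
  -- The inequality |u| ≤ (1 + u²)/2 replaces Cauchy–Schwarz.
  calc ∫ z in Icc a b, |deriv g z| ≤ ∫ z in Icc a b, (1 + deriv g z ^ 2) / 2 := by
        refine setIntegral_mono hac.abs (((integrableOn_const (by simp)).add hint).div_const 2)
          fun z => ?_
        have := two_mul_le_add_sq 1 |deriv g z|
        rw [sq_abs] at this
        simp only
        linarith
    _ = ((b - a) + ∫ z in Icc a b, deriv g z ^ 2) / 2 := by
        rw [integral_div, integral_add (integrableOn_const (C := (1 : ℝ)) (by simp)) hint]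
        simp [hab.le]
    _ ≤ _ := by linarith

theorem nuisanceClass.abs_derivWithin_sub_le (hab : a < b) (hf : f ∈ nuisanceClass a b M)
    {x y : ℝ} (hx : x ∈ Icc a b) (hy : y ∈ Icc a b) :
    |derivWithin f (Icc a b) y - derivWithin f (Icc a b) x| ≤ (b - a + M ^ 2) / 2 := by
  have hac := hf.1.absolutelyContinuous
  have hint := hac.intervalIntegrable_deriv
  rw [intervalIntegrable_iff_integrableOn_Icc_of_le hab.le] at hint
  have hsub : uIcc x y ⊆ Icc a b := ordConnected_Icc.uIcc_subset hx hy
  rw [← (hac.mono (by rwa [uIcc_of_le hab.le])).integral_deriv_eq_sub, ← Real.norm_eq_abs]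
  calc _ ≤ ∫ z in uIoc x y, ‖deriv (derivWithin f (Icc a b)) z‖ :=
        intervalIntegral.norm_integral_le_integral_norm_uIoc
    _ ≤ ∫ z in Icc a b, ‖deriv (derivWithin f (Icc a b)) z‖ :=
        setIntegral_mono_set hint.norm (ae_of_all _ fun z => norm_nonneg _)
          (uIoc_subset_uIcc.trans hsub).eventuallyLE
    _ ≤ _ := nuisanceClass.integral_abs_deriv_le hab hf

/-- The functions in the nuisance class are Lipschitz with a common constant. -/
theorem nuisanceClass.abs_sub_le (hab : a < b) (hf : f ∈ nuisanceClass a b M)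
    {x y : ℝ} (hx : x ∈ Icc a b) (hy : y ∈ Icc a b) :
    |f y - f x| ≤ ((b - a + M ^ 2) / 2 + 2 * M / (b - a)) * |y - x| := by
  have hd : ∀ z ∈ Icc a b, HasDerivWithinAt f (derivWithin f (Icc a b) z) (Icc a b) z :=
    fun z hz => (hf.1.contDiffOn.differentiableOn one_ne_zero z hz).hasDerivWithinAt
  -- At a mean value point the derivative is the slope of the chord, at most 2M/(b - a) in absolute
  -- value; the oscillation bound on f' carries this over to all of [a, b].
  obtain ⟨c, hc, hc'⟩ := exists_hasDerivAt_eq_slope f (derivWithin f (Icc a b)) hab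
    (nuisanceClass.continuousOn hf)
    fun z hz => (hd z (Ioo_subset_Icc_self hz)).hasDerivAt (Icc_mem_nhds hz.1 hz.2)
  have hcb : |derivWithin f (Icc a b) c| ≤ 2 * M / (b - a) := by
    rw [hc', abs_div, abs_of_pos (sub_pos.2 hab)]
    have := sub_pos.2 hab
    gcongr
    have h1 := abs_sub (f b) (f a)
    have h2 := nuisanceClass.abs_le hf (left_mem_Icc.2 hab.le)
    have h3 := nuisanceClass.abs_le hf (right_mem_Icc.2 hab.le)
    linarith
  refine (convex_Icc a b).norm_image_sub_le_of_norm_hasDerivWithin_le hd (fun z hz => ?_) hx hy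
  have h1 := nuisanceClass.abs_derivWithin_sub_le hab hf (Ioo_subset_Icc_self hc) hz
  have h2 := abs_sub_abs_le_abs_sub (derivWithin f (Icc a b) z) (derivWithin f (Icc a b) c)
  rw [Real.norm_eq_abs]
  linarith

/-- A subset of the nuisance class has finite nets in the uniform norm, with centers in the
subset. -/
theorem exists_finite_net (hab : a < b) {H : Set (ℝ → ℝ)} (hH : H ⊆ nuisanceClass a b M)
    {ε : ℝ} (hε : 0 < ε) :
    ∃ T : Set (ℝ → ℝ), T ⊆ H ∧ T.Finite ∧
      ∀ k ∈ H, ∃ k' ∈ T, ∀ z ∈ Icc a b, |k z - k' z| < ε := by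
  let F : H → BoundedContinuousFunction (Icc a b) ℝ := fun k =>
    BoundedContinuousFunction.mkOfCompact
      ⟨(Icc a b).domRestrict k.1, (nuisanceClass.continuousOn (hH k.2)).domRestrict⟩
  have hcpt : IsCompact (closure (range F)) := by
    refine BoundedContinuousFunction.arzela_ascoli (Icc (-M) M) isCompact_Icc _ ?_ ?_
    · rintro _ x ⟨k, rfl⟩
      exact abs_le.1 (nuisanceClass.abs_le (hH k.2) x.2)
    · set L := (b - a + M ^ 2) / 2 + 2 * M / (b - a)
      refine Metric.equicontinuous_of_continuity_modulus (fun r => L * r) ?_ _ ?_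
      · simpa using (continuous_const_mul L).tendsto 0
      · rintro x y ⟨_, k, rfl⟩
        exact nuisanceClass.abs_sub_le hab (hH k.2) y.2 x.2
  -- The net is drawn from `range F` itself, not from its closure, so its centers come from `H`.
  obtain ⟨t, ht, htf, htc⟩ := Metric.finite_approx_of_totallyBounded
    (hcpt.totallyBounded.subset subset_closure) ε hε
  choose g hg using fun x : t => ht x.2
  have := htf.to_subtype
  refine ⟨range fun x => (g x).1, ?_, finite_range _, fun k hk => ?_⟩
  · rintro _ ⟨x, rfl⟩
    exact (g x).2
  · obtain ⟨x, hx, hkx⟩ := mem_iUnion₂.1 (htc ⟨⟨k, hk⟩, rfl⟩)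
    refine ⟨_, ⟨⟨x, hx⟩, rfl⟩, fun z hz => ?_⟩
    have h1 := BoundedContinuousFunction.dist_coe_le_dist (f := F ⟨k, hk⟩) (g := x) ⟨z, hz⟩
    have h2 : F (g ⟨x, hx⟩) = x := hg ⟨x, hx⟩
    rw [← h2] at h1
    exact h1.trans_lt (by rw [h2]; exact hkx)

end Nuisance

/-- The set of possible values of an observation. -/
def obsSpace (lc uc : ℝ) (K : Set ℝ) (a b : ℝ) : Set (ℝ × ℝ × ℝ × ℝ) :=
  Icc lc uc ×ˢ ({0, 1} : Set ℝ) ×ˢ K ×ˢ Icc a b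

/-- The arguments of `Φ` in the likelihood are uniformly bounded. -/
theorem exists_bound_index {a b M : ℝ} {Θ K : Set ℝ} (hΘ : IsCompact Θ) (hK : IsCompact K)
    (lc uc : ℝ) :
    ∃ R : ℝ, ∀ θ ∈ Θ, ∀ k ∈ nuisanceClass a b M, ∀ c ∈ Icc lc uc, ∀ w ∈ K, ∀ z ∈ Icc a b,
      |c - θ * w - k z| ≤ R := by
  obtain ⟨BK, hBK⟩ := hK.isBounded.exists_norm_le
  obtain ⟨BΘ, hBΘ⟩ := hΘ.isBounded.exists_norm_le
  refine ⟨|lc| + |uc| + BΘ * BK + M, fun θ hθ k hk c hc w hw z hz => ?_⟩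
  have h1 : |c| ≤ |lc| + |uc| := abs_le.2 ⟨by
    linarith [neg_abs_le lc, abs_nonneg uc, hc.1], by linarith [le_abs_self uc, abs_nonneg lc, hc.2]⟩
  have h2 : |θ * w| ≤ BΘ * BK := by
    rw [abs_mul]
    exact mul_le_mul (hBΘ θ hθ) (hBK w hw) (abs_nonneg _) ((norm_nonneg _).trans (hBΘ θ hθ))
  have h3 := nuisanceClass.abs_le hk hz
  have h4 := abs_sub (c - θ * w) (k z)
  have h5 := abs_sub c (θ * w)
  linarith

/-- The log-likelihoods have finite nets in the uniform norm on the space of observations. -/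
theorem exists_finite_cover {a b M : ℝ} (hab : a < b) {H : Set (ℝ → ℝ)}
    (hH : H ⊆ nuisanceClass a b M) {Θ K : Set ℝ} (hΘ : IsCompact Θ) (hK : IsCompact K)
    (lc uc : ℝ) {η : ℝ} (hη : 0 < η) :
    ∃ T : Set (ℝ × (ℝ → ℝ)), T ⊆ Θ ×ˢ H ∧ T.Finite ∧ ∀ θ ∈ Θ, ∀ k ∈ H, ∃ t ∈ T,
      ∀ x ∈ obsSpace lc uc K a b, |logLik θ k x - logLik t.1 t.2 x| ≤ η := by
  obtain ⟨R, hR⟩ := exists_bound_index (a := a) (b := b) (M := M) hΘ hK lc uc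
  obtain ⟨B, hB⟩ := hK.isBounded.exists_norm_le
  -- log Φ and log(1 - Φ) are uniformly continuous only on bounded intervals, hence the restriction
  -- to [-R, R].
  obtain ⟨δ₁, hδ₁, h₁⟩ := Metric.uniformContinuousOn_iff.1
    (isCompact_Icc.uniformContinuousOn_of_continuous
      (s := Icc (-R) R) continuous_log_Phi.continuousOn) η hη
  obtain ⟨δ₂, hδ₂, h₂⟩ := Metric.uniformContinuousOn_iff.1
    (isCompact_Icc.uniformContinuousOn_of_continuous
      (s := Icc (-R) R) continuous_log_one_sub_Phi.continuousOn) η hη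
  set δ := min δ₁ δ₂
  have hδ : 0 < δ := lt_min hδ₁ hδ₂
  obtain ⟨T₂, hT₂, hT₂f, hT₂c⟩ := exists_finite_net hab hH (half_pos hδ)
  have hB1 : 0 < |B| + 1 := by positivity
  obtain ⟨T₁, hT₁, hT₁f, hT₁c⟩ := Metric.finite_approx_of_totallyBounded hΘ.totallyBounded
    (δ / 2 / (|B| + 1)) (by positivity)
  refine ⟨T₁ ×ˢ T₂, prod_mono hT₁ hT₂, hT₁f.prod hT₂f, fun θ hθ k hk => ?_⟩
  obtain ⟨θ', hθ', hθθ'⟩ := mem_iUnion₂.1 (hT₁c hθ)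
  obtain ⟨k', hk', hkk'⟩ := hT₂c k hk
  refine ⟨(θ', k'), ⟨hθ', hk'⟩, ?_⟩
  rintro ⟨c, d, w, z⟩ ⟨hc, hd, hw, hz⟩
  have hu := abs_le.1 (hR θ hθ k (hH hk) c hc w hw z hz)
  have hu' := abs_le.1 (hR θ' (hT₁ hθ') k' (hH (hT₂ hk')) c hc w hw z hz)
  have hdist : dist (c - θ * w - k z) (c - θ' * w - k' z) < δ := by
    rw [Real.dist_eq, show c - θ * w - k z - (c - θ' * w - k' z) =
      -((θ - θ') * w) - (k z - k' z) by ring]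
    have h3 : |(θ - θ') * w| ≤ δ / 2 := by
      rw [abs_mul]
      have h4 : |θ - θ'| ≤ δ / 2 / (|B| + 1) := hθθ'.le
      have h5 : |w| ≤ |B| + 1 := by linarith [show |w| ≤ B from hB w hw, le_abs_self B]
      calc _ ≤ δ / 2 / (|B| + 1) * (|B| + 1) := mul_le_mul h4 h5 (abs_nonneg _) (by positivity)
        _ = _ := div_mul_cancel₀ _ hB1.ne'
    have h4 := abs_sub (-((θ - θ') * w)) (k z - k' z)
    rw [abs_neg] at h4
    linarith [hkk' z hz]
  rcases hd with hd | hd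
  · have hd : d = 0 := hd
    subst hd
    simpa [logLik, Real.dist_eq] using (h₂ _ hu _ hu' (hdist.trans_le (min_le_right _ _))).le
  · have hd : d = 1 := hd
    subst hd
    simpa [logLik, Real.dist_eq] using (h₁ _ hu _ hu' (hdist.trans_le (min_le_left _ _))).le

/-- Members of the class are arbitrary off [a, b], possibly nonmeasurable; the extension is a
measurable substitute that agrees almost surely at Z. -/
theorem exists_continuous_eqOn {a b M : ℝ} (hab : a < b) {k : ℝ → ℝ}
    (hk : k ∈ nuisanceClass a b M) : ∃ k' : ℝ → ℝ, Continuous k' ∧ EqOn k' k (Icc a b) :=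
  ⟨IccExtend hab.le ((Icc a b).domRestrict k),
    (nuisanceClass.continuousOn hk).domRestrict.Icc_extend',
    fun z hz => by simp [IccExtend_of_mem hab.le _ hz]⟩

theorem measurable_logLik (θ : ℝ) {k : ℝ → ℝ} (hk : Continuous k) : Measurable (logLik θ k) := by
  have hu : Measurable fun x : ℝ × ℝ × ℝ × ℝ => x.1 - θ * x.2.2.1 - k x.2.2.2 := by fun_prop
  exact (measurable_snd.fst.mul (continuous_log_Phi.measurable.comp hu)).add
    ((measurable_const.sub measurable_snd.fst).mul
      (continuous_log_one_sub_Phi.measurable.comp hu))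

theorem logLik_congr {θ : ℝ} {k k' : ℝ → ℝ} {lc uc a b : ℝ} {K : Set ℝ} (h : EqOn k' k (Icc a b))
    {x : ℝ × ℝ × ℝ × ℝ} (hx : x ∈ obsSpace lc uc K a b) : logLik θ k' x = logLik θ k x := by
  obtain ⟨c, d, w, z⟩ := x
  simp only [logLik, h hx.2.2.2]

theorem exists_bound_logLik {a b M : ℝ} {K : Set ℝ} (hK : IsCompact K)
    (lc uc θ : ℝ) {k : ℝ → ℝ} (hk : k ∈ nuisanceClass a b M) :
    ∃ B, ∀ x ∈ obsSpace lc uc K a b, |logLik θ k x| ≤ B := by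
  obtain ⟨R, hR⟩ := exists_bound_index (a := a) (b := b) (M := M)
    (isCompact_singleton (x := θ)) hK lc uc
  obtain ⟨B₁, h₁⟩ := (isCompact_Icc (a := -R) (b := R)).exists_bound_of_continuousOn
    continuous_log_Phi.continuousOn
  obtain ⟨B₂, h₂⟩ := (isCompact_Icc (a := -R) (b := R)).exists_bound_of_continuousOn
    continuous_log_one_sub_Phi.continuousOn
  refine ⟨max B₁ B₂, ?_⟩
  rintro ⟨c, d, w, z⟩ ⟨hc, hd, hw, hz⟩
  have hu := abs_le.1 (hR θ rfl k hk c hc w hw z hz)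
  rcases hd with hd | hd
  · have hd : d = 0 := hd
    subst hd
    simpa [logLik] using Or.inr (h₂ _ hu)
  · have hd : d = 1 := hd
    subst hd
    simpa [logLik] using Or.inl (h₁ _ hu)

theorem measurableSet_obsSpace {lc uc a b : ℝ} {K : Set ℝ} (hK : IsCompact K) :
    MeasurableSet (obsSpace lc uc K a b) :=
  measurableSet_Icc.prod ((Set.toFinite _).measurableSet.prod (hK.measurableSet.prod
    measurableSet_Icc))

/-! ### The conditional law of the indicator -/

section Model

variable {Ω₀ : Type*} [MeasurableSpace Ω₀] [StandardBorelSpace Ω₀] {P : Measure Ω₀}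
  [IsProbabilityMeasure P] {Y C W Z : Ω₀ → ℝ} {θ₀ : ℝ} {k₀ : ℝ → ℝ} {lc uc : ℝ} {K : Set ℝ}
  {a b : ℝ}

theorem IsModel.measurable_observation (h : IsModel P Y C W Z θ₀ k₀ lc uc K a b) :
    Measurable (observation Y C W Z) :=
  h.measurable_C.prodMk ((Measurable.ite (measurableSet_le h.measurable_Y h.measurable_C)
    measurable_const measurable_const).prodMk (h.measurable_W.prodMk h.measurable_Z))

theorem IsModel.observation_mem (h : IsModel P Y C W Z θ₀ k₀ lc uc K a b) :
    ∀ᵐ ω ∂P, observation Y C W Z ω ∈ obsSpace lc uc K a b := by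
  filter_upwards [h.C_mem, h.W_mem, h.Z_mem] with ω h1 h2 h3
  refine ⟨h1, ?_, h2, h3⟩
  by_cases hle : Y ω ≤ C ω <;> simp [observation, hle]

theorem IsModel.integrable_logLik (h : IsModel P Y C W Z θ₀ k₀ lc uc K a b) (hab : a < b)
    (hK : IsCompact K) {M : ℝ} (θ : ℝ) {k : ℝ → ℝ} (hk : k ∈ nuisanceClass a b M) :
    Integrable (fun ω => logLik θ k (observation Y C W Z ω)) P := by
  obtain ⟨k', hk', hkk'⟩ := exists_continuous_eqOn hab hk
  obtain ⟨B, hB⟩ := exists_bound_logLik hK lc uc θ hk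
  refine Integrable.of_bound (C := B) ?_ (h.observation_mem.mono fun ω hω => hB _ hω)
  refine (((measurable_logLik θ hk').comp h.measurable_observation).aestronglyMeasurable).congr ?_
  filter_upwards [h.observation_mem] with ω hω using logLik_congr hkk' hω

/-- Given the covariates and the censoring time, the outcome is normal with mean `θ₀ w + k₀ z`. -/
theorem IsModel.map_eq_compProd (h : IsModel P Y C W Z θ₀ k₀ lc uc K a b) {k : ℝ → ℝ}
    (hk : Continuous k) (hkk : EqOn k k₀ (Icc a b)) (κ : Kernel ((ℝ × ℝ) × ℝ) ℝ) [IsFiniteKernel κ]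
    (hκ : ∀ v, κ v = gaussianReal (θ₀ * v.1.1 + k v.1.2) 1) :
    P.map (fun ω => (((W ω, Z ω), C ω), Y ω)) = P.map (fun ω => ((W ω, Z ω), C ω)) ⊗ₘ κ := by
  have hW := h.measurable_W
  have hZ := h.measurable_Z
  have hY := h.measurable_Y
  have hC := h.measurable_C
  have hV : Measurable fun ω => (W ω, Z ω) := hW.prodMk hZ
  set ξ : Ω₀ → ℝ := fun ω => Y ω - θ₀ * W ω - k (Z ω) with hξ
  have hξm : Measurable ξ := by fun_prop
  have hξe : (fun ω => Y ω - θ₀ * W ω - k₀ (Z ω)) =ᵐ[P] ξ := by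
    filter_upwards [h.Z_mem] with ω hω
    simp only [hξ, hkk hω]
  have hlaw : P.map ξ = gaussianReal 0 1 := by
    rw [← Measure.map_congr hξe, h.residual_law.map_eq]
  have hind : IndepFun (fun ω => (W ω, Z ω)) ξ P :=
    (h.residual_indep.congr hξe EventuallyEq.rfl).symm
  rw [indepFun_iff_map_prod_eq_prod_map_map hV.aemeasurable hξm.aemeasurable, hlaw] at hind
  -- `κ` does not depend on the censoring time, so any value, here 0, may be inserted.
  let κ' : Kernel (ℝ × ℝ) ℝ := κ.comap (fun v => (v, 0)) (by fun_prop)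
  have hκ' : ∀ v, κ' v = (gaussianReal 0 1).map (fun x => θ₀ * v.1 + k v.2 + x) := fun v => by
    rw [Kernel.comap_apply, hκ, gaussianReal_map_const_add, zero_add]
  have hφ : Measurable fun p : (ℝ × ℝ) × ℝ => (p.1, θ₀ * p.1.1 + k p.1.2 + p.2) := by fun_prop
  have hVY : P.map (fun ω => ((W ω, Z ω), Y ω)) = P.map (fun ω => (W ω, Z ω)) ⊗ₘ κ' := by
    have h1 : (fun ω => ((W ω, Z ω), Y ω)) =
        (fun p : (ℝ × ℝ) × ℝ => (p.1, θ₀ * p.1.1 + k p.1.2 + p.2)) ∘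
          fun ω => ((W ω, Z ω), ξ ω) := by
      funext ω
      simp [hξ]
    rw [h1, ← Measure.map_map hφ (hV.prodMk hξm), hind]
    ext s hs
    rw [Measure.map_apply hφ hs, Measure.prod_apply (hφ hs), Measure.compProd_apply hs]
    refine lintegral_congr fun v => ?_
    rw [hκ', Measure.map_apply (by fun_prop) (measurable_prodMk_left hs)]
    rfl
  have h1 := condDistrib_ae_eq_of_measure_eq_compProd _ hY.aemeasurable hVY
  -- Conditional independence: conditioning on C as well leaves the law of Y given (W, Z) unchanged.
  have h2 := (condIndepFun_iff_condDistrib_prod_ae_eq_prodMkRight hY hC hV).1 h.condIndep.symm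
  refine (condDistrib_ae_eq_iff_measure_eq_compProd _ hY.aemeasurable κ).1 (h2.trans ?_)
  have h3 : P.map (fun ω => (W ω, Z ω)) = (P.map (fun ω => ((W ω, Z ω), C ω))).map Prod.fst := by
    rw [Measure.map_map measurable_fst (hV.prodMk hC)]
    rfl
  rw [h3] at h1
  filter_upwards [ae_of_ae_map measurable_fst.aemeasurable h1] with v hv
  rw [Kernel.prodMkRight_apply, hv, Kernel.comap_apply, hκ, hκ]

/-- The tower property, with Φ(C - θ₀W - k₀(Z)) as the conditional probability of Y ≤ C given (W, Z,
C). -/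
theorem IsModel.integral_indicator_mul (h : IsModel P Y C W Z θ₀ k₀ lc uc K a b) {k : ℝ → ℝ}
    (hk : Continuous k) (hkk : EqOn k k₀ (Icc a b)) {g : (ℝ × ℝ) × ℝ → ℝ} (hg : Measurable g)
    (hgi : Integrable (fun ω => g ((W ω, Z ω), C ω)) P) :
    ∫ ω, (observation Y C W Z ω).2.1 * g ((W ω, Z ω), C ω) ∂P =
      ∫ ω, Phi (C ω - θ₀ * W ω - k (Z ω)) * g ((W ω, Z ω), C ω) ∂P := by
  have hVC : Measurable fun ω => ((W ω, Z ω), C ω) :=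
    (h.measurable_W.prodMk h.measurable_Z).prodMk h.measurable_C
  let κ : Kernel ((ℝ × ℝ) × ℝ) ℝ :=
    ⟨fun v => gaussianReal (θ₀ * v.1.1 + k v.1.2) 1,
      measurable_gaussianReal.comp (g := Function.uncurry gaussianReal)
        (f := fun v : (ℝ × ℝ) × ℝ => (θ₀ * v.1.1 + k v.1.2, (1 : NNReal))) (by fun_prop)⟩
  have hκ : ∀ v, κ v = gaussianReal (θ₀ * v.1.1 + k v.1.2) 1 := fun v => rfl
  have : IsMarkovKernel κ := ⟨fun v => by rw [hκ]; infer_instance⟩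
  have hmap := h.map_eq_compProd hk hkk κ hκ
  let F : ((ℝ × ℝ) × ℝ) × ℝ → ℝ := fun p => (if p.2 ≤ p.1.2 then 1 else 0) * g p.1
  have hF : Measurable F := (Measurable.ite (measurableSet_le (by fun_prop) (by fun_prop))
    measurable_const measurable_const).mul (hg.comp measurable_fst)
  have hFe : ∀ ω, F (((W ω, Z ω), C ω), Y ω) =
      (observation Y C W Z ω).2.1 * g ((W ω, Z ω), C ω) := fun ω => by
    by_cases hle : Y ω ≤ C ω <;> simp [F, observation, hle]
  have hFi : Integrable (fun ω => F (((W ω, Z ω), C ω), Y ω)) P := by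
    refine hgi.mono (hF.comp (hVC.prodMk h.measurable_Y)).aestronglyMeasurable
      (ae_of_all _ fun ω => ?_)
    by_cases hle : Y ω ≤ C ω <;> simp [F, hle]
  simp_rw [← hFe]
  have hFi' : Integrable F (P.map fun ω => (((W ω, Z ω), C ω), Y ω)) :=
    (integrable_map_measure hF.aestronglyMeasurable
      (hVC.prodMk h.measurable_Y).aemeasurable).2 hFi
  have hin : ∀ v, ∫ y, F (v, y) ∂κ v = Phi (v.2 - θ₀ * v.1.1 - k v.1.2) * g v := fun v => by
    simp only [F]
    rw [integral_mul_const]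
    congr 1
    have h1 : (fun y => if y ≤ v.2 then (1 : ℝ) else 0) = (Iic v.2).indicator 1 := by
      funext y
      simp [indicator_apply]
    rw [h1, integral_indicator_one measurableSet_Iic, hκ, Phi_eq_real,
      ← zero_add (θ₀ * v.1.1 + k v.1.2), ← gaussianReal_map_const_add,
      map_measureReal_apply (by fun_prop) measurableSet_Iic]
    congr 1
    ext y
    simp only [mem_preimage, mem_Iic]
    constructor <;> intro <;> linarith
  rw [← integral_map (φ := fun ω => (((W ω, Z ω), C ω), Y ω)) (f := F)
    (hVC.prodMk h.measurable_Y).aemeasurable hF.aestronglyMeasurable, hmap,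
    Measure.integral_compProd (hmap ▸ hFi')]
  simp_rw [hin]
  rw [integral_map (f := fun v : (ℝ × ℝ) × ℝ => Phi (v.2 - θ₀ * v.1.1 - k v.1.2) * g v)
    hVC.aemeasurable]
  exact ((continuous_Phi.measurable.comp (by fun_prop)).mul hg).aestronglyMeasurable

end Model

/-- The mean square distance of a multiple of `W` from any function of `Z` is at least that from
its conditional expectation. -/
theorem sq_mul_integral_condVar_le {Ω₀ : Type*} {m₀ : MeasurableSpace Ω₀} {P : Measure Ω₀}
    [IsProbabilityMeasure P] {m : MeasurableSpace Ω₀} (hm : m ≤ m₀) {W G : Ω₀ → ℝ}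
    (hW : MemLp W 2 P) (hG : MemLp G 2 P) (hGm : StronglyMeasurable[m] G) (t : ℝ) :
    t ^ 2 * ∫ ω, condVar m W P ω ∂P ≤ ∫ ω, (t * W ω + G ω) ^ 2 ∂P := by
  have hV : MemLp (t • W + G) 2 P := (hW.const_smul t).add hG
  -- Adding an `m`-measurable function leaves the conditional variance unchanged.
  have h1 : condVar m (t • W) P =ᵐ[P] condVar m (t • W + G) P := by
    refine condExp_congr_ae ?_
    filter_upwards [condExp_add ((hW.const_smul t).integrable one_le_two)
      (hG.integrable one_le_two) m] with ω hω
    rw [Pi.pow_apply, Pi.pow_apply, Pi.sub_apply, Pi.sub_apply, hω, Pi.add_apply, Pi.add_apply,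
      condExp_of_stronglyMeasurable hm hGm (hG.integrable one_le_two)]
    ring
  calc t ^ 2 * ∫ ω, condVar m W P ω ∂P = ∫ ω, condVar m (t • W + G) P ω ∂P := by
        rw [← integral_const_mul]
        refine integral_congr_ae ?_
        filter_upwards [condVar_smul (m := m) (μ := P) t W, h1] with ω h2 h3
        rw [← h3, h2]
        rfl
    _ ≤ ∫ ω, (P[(t • W + G) ^ 2 | m]) ω ∂P :=
        integral_mono_ae integrable_condVar integrable_condExp (condVar_ae_le_condExp_sq hm hV)
    _ = ∫ ω, ((t • W + G) ^ 2) ω ∂P := integral_condExp hm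
    _ = _ := rfl

/-! ### Separation of the expected log-likelihood -/

section Model

variable {Ω₀ : Type*} [MeasurableSpace Ω₀] [StandardBorelSpace Ω₀] {P : Measure Ω₀}
  [IsProbabilityMeasure P] {Y C W Z : Ω₀ → ℝ} {θ₀ : ℝ} {k₀ : ℝ → ℝ} {lc uc : ℝ} {K : Set ℝ}
  {a b : ℝ}

/-- The expected log-likelihood, with the indicator replaced by its conditional expectation. -/
theorem IsModel.integral_logLik (h : IsModel P Y C W Z θ₀ k₀ lc uc K a b) (hab : a < b)
    (hK : IsCompact K) {M : ℝ} (hk₀ : k₀ ∈ nuisanceClass a b M) (θ : ℝ) {k : ℝ → ℝ}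
    (hk : k ∈ nuisanceClass a b M) :
    Integrable (fun ω => logLik θ k
      (C ω, Phi (C ω - θ₀ * W ω - k₀ (Z ω)), W ω, Z ω)) P ∧
    ∫ ω, logLik θ k (observation Y C W Z ω) ∂P = ∫ ω, logLik θ k
      (C ω, Phi (C ω - θ₀ * W ω - k₀ (Z ω)), W ω, Z ω) ∂P := by
  obtain ⟨k', hk', hkk'⟩ := exists_continuous_eqOn hab hk
  obtain ⟨k₀', hk₀', hkk₀'⟩ := exists_continuous_eqOn hab hk₀
  have hVC : Measurable fun ω => ((W ω, Z ω), C ω) :=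
    (h.measurable_W.prodMk h.measurable_Z).prodMk h.measurable_C
  let u : (ℝ × ℝ) × ℝ → ℝ := fun v => v.2 - θ * v.1.1 - k' v.1.2
  have hu : Measurable u := by fun_prop
  let g₁ : (ℝ × ℝ) × ℝ → ℝ := fun v => Real.log (Phi (u v))
  let g₂ : (ℝ × ℝ) × ℝ → ℝ := fun v => Real.log (1 - Phi (u v))
  have hg₁ : Measurable g₁ := continuous_log_Phi.measurable.comp hu
  have hg₂ : Measurable g₂ := continuous_log_one_sub_Phi.measurable.comp hu
  obtain ⟨B, hB⟩ := exists_bound_logLik hK lc uc θ hk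
  have hb : ∀ᵐ ω ∂P, |g₁ ((W ω, Z ω), C ω)| ≤ B ∧ |g₂ ((W ω, Z ω), C ω)| ≤ B := by
    filter_upwards [h.C_mem, h.W_mem, h.Z_mem] with ω h1 h2 h3
    constructor
    · simpa [logLik, g₁, u, hkk' h3] using hB (C ω, 1, W ω, Z ω) ⟨h1, by simp, h2, h3⟩
    · simpa [logLik, g₂, u, hkk' h3] using hB (C ω, 0, W ω, Z ω) ⟨h1, by simp, h2, h3⟩
  have hi₁ : Integrable (fun ω => g₁ ((W ω, Z ω), C ω)) P :=
    Integrable.of_bound (C := B) (hg₁.comp hVC).aestronglyMeasurable (hb.mono fun ω hω => hω.1)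
  have hi₂ : Integrable (fun ω => g₂ ((W ω, Z ω), C ω)) P :=
    Integrable.of_bound (C := B) (hg₂.comp hVC).aestronglyMeasurable (hb.mono fun ω hω => hω.2)
  have hΦ : Measurable fun ω => Phi (C ω - θ₀ * W ω - k₀' (Z ω)) :=
    continuous_Phi.measurable.comp ((h.measurable_C.sub (h.measurable_W.const_mul θ₀)).sub
      (hk₀'.measurable.comp h.measurable_Z))
  -- The log-likelihood is affine in the indicator, so only its slope `g₁ - g₂` meets the tower
  -- property.
  have e₁ : ∀ᵐ ω ∂P, logLik θ k (observation Y C W Z ω) =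
      (observation Y C W Z ω).2.1 * (g₁ - g₂) ((W ω, Z ω), C ω) + g₂ ((W ω, Z ω), C ω) := by
    filter_upwards [h.Z_mem] with ω hω
    simp only [logLik, observation, g₁, g₂, u, hkk' hω, Pi.sub_apply]
    ring
  have e₂ : ∀ᵐ ω ∂P, logLik θ k (C ω, Phi (C ω - θ₀ * W ω - k₀ (Z ω)), W ω, Z ω) =
      Phi (C ω - θ₀ * W ω - k₀' (Z ω)) * (g₁ - g₂) ((W ω, Z ω), C ω) +
        g₂ ((W ω, Z ω), C ω) := by
    filter_upwards [h.Z_mem] with ω hω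
    simp only [logLik, g₁, g₂, u, hkk' hω, hkk₀' hω, Pi.sub_apply]
    ring
  have hi₃ : Integrable (fun ω => (observation Y C W Z ω).2.1 * (g₁ - g₂) ((W ω, Z ω), C ω)) P :=
    (hi₁.sub hi₂).bdd_mul (c := 1)
      h.measurable_observation.snd.fst.aestronglyMeasurable (ae_of_all _ fun ω => by
        by_cases hle : Y ω ≤ C ω <;> simp [observation, hle])
  have hi₄ : Integrable (fun ω => Phi (C ω - θ₀ * W ω - k₀' (Z ω)) *
      (g₁ - g₂) ((W ω, Z ω), C ω)) P :=
    (hi₁.sub hi₂).bdd_mul (c := 1) hΦ.aestronglyMeasurable (ae_of_all _ fun ω => by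
      rw [Real.norm_eq_abs, abs_of_pos (Phi_pos _)]
      exact (Phi_lt_one _).le)
  refine ⟨(hi₄.add hi₂).congr (e₂.mono fun ω hω => hω.symm), ?_⟩
  rw [integral_congr_ae e₁, integral_congr_ae e₂, integral_add hi₃ hi₂, integral_add hi₄ hi₂,
    h.integral_indicator_mul hk₀' hkk₀' (hg₁.sub hg₂) (hi₁.sub hi₂)]

/-- The expected log-likelihood is well separated in `θ`, uniformly in the nuisance parameter. -/
theorem IsModel.exists_integral_logLik_le (h : IsModel P Y C W Z θ₀ k₀ lc uc K a b) (hab : a < b)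
    (hK : IsCompact K) {M : ℝ} (hk₀ : k₀ ∈ nuisanceClass a b M) {Θ : Set ℝ} (hΘ : IsCompact Θ)
    (hθ₀ : θ₀ ∈ Θ) :
    ∃ c > 0, ∀ θ ∈ Θ, ∀ k ∈ nuisanceClass a b M,
      ∫ ω, logLik θ k (observation Y C W Z ω) ∂P ≤
        ∫ ω, logLik θ₀ k₀ (observation Y C W Z ω) ∂P - c * (θ - θ₀) ^ 2 := by
  obtain ⟨R, hR⟩ := exists_bound_index (a := a) (b := b) (M := M) hΘ hK lc uc
  obtain ⟨B, hB⟩ := hK.isBounded.exists_norm_le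
  set r := gaussianPDFReal 0 1 R
  have hr : 0 < r := gaussianPDFReal_pos 0 1 R one_ne_zero
  set v := ∫ ω, condVar (MeasurableSpace.comap Z inferInstance) W P ω ∂P
  have hv : 0 < v := h.condVar_pos
  -- The factor 1/2 comes from the Bernoulli bound, `r ^ 2` from the slope of Φ, and `v` from the
  -- part of W not explained by Z.
  refine ⟨r ^ 2 / 2 * v, by positivity, fun θ hθ k hk => ?_⟩
  obtain ⟨k', hk', hkk'⟩ := exists_continuous_eqOn hab hk
  obtain ⟨k₀', hk₀', hkk₀'⟩ := exists_continuous_eqOn hab hk₀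
  obtain ⟨i₁, e₁⟩ := h.integral_logLik hab hK hk₀ θ hk
  obtain ⟨i₀, e₀⟩ := h.integral_logLik hab hK hk₀ θ₀ hk₀
  have hW : MemLp W 2 P := MemLp.of_bound h.measurable_W.aestronglyMeasurable B
    (h.W_mem.mono fun ω hω => hB _ hω)
  have hGm : Measurable[MeasurableSpace.comap Z inferInstance] fun ω => k' (Z ω) - k₀' (Z ω) :=
    (hk'.sub hk₀').measurable.comp (comap_measurable Z)
  have hG : MemLp (fun ω => k' (Z ω) - k₀' (Z ω)) 2 P := by
    refine MemLp.of_bound (hGm.mono h.measurable_Z.comap_le le_rfl).aestronglyMeasurable (M + M)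
      (h.Z_mem.mono fun ω hω => ?_)
    rw [hkk' hω, hkk₀' hω]
    exact (abs_sub _ _).trans (add_le_add (nuisanceClass.abs_le hk hω)
      (nuisanceClass.abs_le hk₀ hω))
  have hvar := sq_mul_integral_condVar_le h.measurable_Z.comap_le hW hG
    hGm.stronglyMeasurable (θ - θ₀)
  have hsq : Integrable (fun ω => ((θ - θ₀) * W ω + (k' (Z ω) - k₀' (Z ω))) ^ 2) P :=
    ((hW.const_mul _).add hG).integrable_sq
  rw [e₁, e₀]
  calc _ ≤ ∫ ω, (logLik θ₀ k₀ (C ω, Phi (C ω - θ₀ * W ω - k₀ (Z ω)), W ω, Z ω) -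
        r ^ 2 / 2 * ((θ - θ₀) * W ω + (k' (Z ω) - k₀' (Z ω))) ^ 2) ∂P := by
        refine integral_mono_ae i₁ (i₀.sub (hsq.const_mul _)) ?_
        filter_upwards [h.C_mem, h.W_mem, h.Z_mem] with ω h1 h2 h3
        simp only [logLik, hkk' h3, hkk₀' h3]
        set x := C ω - θ * W ω - k (Z ω) with hx
        set y := C ω - θ₀ * W ω - k₀ (Z ω) with hy
        refine (bernoulli_log_le (Phi_pos y) (Phi_lt_one y) (Phi_pos x) (Phi_lt_one x)).trans ?_
        have h4 := le_abs_Phi_sub_Phi (hR θ hθ k hk _ h1 _ h2 _ h3)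
          (hR θ₀ hθ₀ k₀ hk₀ _ h1 _ h2 _ h3)
        have h5 := pow_le_pow_left₀ (by positivity) h4 2
        rw [mul_pow, sq_abs, sq_abs] at h5
        have h6 : (θ - θ₀) * W ω + (k (Z ω) - k₀ (Z ω)) = y - x := by rw [hx, hy]; ring
        rw [h6]
        change r ^ 2 * (y - x) ^ 2 ≤ (Phi y - Phi x) ^ 2 at h5
        linarith
    _ = ∫ ω, logLik θ₀ k₀ (C ω, Phi (C ω - θ₀ * W ω - k₀ (Z ω)), W ω, Z ω) ∂P -
        r ^ 2 / 2 * ∫ ω, ((θ - θ₀) * W ω + (k' (Z ω) - k₀' (Z ω))) ^ 2 ∂P := by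
        rw [integral_sub i₀ (hsq.const_mul _), integral_const_mul]
    _ ≤ _ := by
        have := mul_le_mul_of_nonneg_left hvar (by positivity : 0 ≤ r ^ 2 / 2)
        nlinarith

end Model

variable {Ω : Type*}

/-! ### Bounds on the profile likelihood -/

section Sample

variable {H : Set (ℝ → ℝ)} {X : ℕ → Ω → ℝ × ℝ × ℝ × ℝ} {n : ℕ} {ω : Ω}
  {lc uc a b : ℝ} {K : Set ℝ}

/-- This makes the supremum in `profileLik` a genuine one: a real supremum of an unbounded family
would be 0. -/
theorem likN_le_one (hX : ∀ i, X i ω ∈ obsSpace lc uc K a b) (θ : ℝ) (k : ℝ → ℝ) :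
    likN X n ω θ k ≤ 1 :=
  Real.exp_le_one_iff.2 (Finset.sum_nonpos fun i _ => logLik_nonpos θ k _ _ _ _ (hX i).2.1)

theorem likN_le_profileLik (hX : ∀ i, X i ω ∈ obsSpace lc uc K a b) (θ : ℝ) {k : ℝ → ℝ}
    (hk : k ∈ H) : likN X n ω θ k ≤ profileLik H X n ω θ :=
  le_ciSup (f := fun k : H => likN X n ω θ k)
    ⟨1, by rintro _ ⟨k, rfl⟩; exact likN_le_one hX θ k⟩ ⟨k, hk⟩

theorem sum_logLik_le_log_profileLik (hX : ∀ i, X i ω ∈ obsSpace lc uc K a b) (θ : ℝ) {k : ℝ → ℝ}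
    (hk : k ∈ H) :
    ∑ i ∈ Finset.range n, logLik θ k (X i ω) ≤ Real.log (profileLik H X n ω θ) := by
  rw [← Real.log_exp (∑ i ∈ Finset.range n, logLik θ k (X i ω))]
  exact Real.log_le_log (Real.exp_pos _) (likN_le_profileLik hX θ hk)

theorem log_profileLik_le (hX : ∀ i, X i ω ∈ obsSpace lc uc K a b) {θ B : ℝ} {k₀ : ℝ → ℝ}
    (hk₀ : k₀ ∈ H) (hB : ∀ k ∈ H, ∑ i ∈ Finset.range n, logLik θ k (X i ω) ≤ B) :
    Real.log (profileLik H X n ω θ) ≤ B := by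
  have : Nonempty H := ⟨⟨k₀, hk₀⟩⟩
  rw [← Real.log_exp B]
  exact Real.log_le_log ((Real.exp_pos _).trans_le (likN_le_profileLik hX θ hk₀))
    (ciSup_le fun k => Real.exp_le_exp.2 (hB k k.2))

theorem IsProfileMLE.log_le {Θ : Set ℝ} {θhat θ : ℝ} (h : IsProfileMLE Θ H X n ω θhat)
    (hθ : θ ∈ Θ) (hX : ∀ i, X i ω ∈ obsSpace lc uc K a b) {k : ℝ → ℝ} (hk : k ∈ H) :
    ∑ i ∈ Finset.range n, logLik θ k (X i ω) ≤ Real.log (profileLik H X n ω θhat) :=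
  (sum_logLik_le_log_profileLik hX θ hk).trans <|
    Real.log_le_log ((Real.exp_pos _).trans_le (likN_le_profileLik hX θ hk)) (h.2 hθ)

end Sample

/-- The empirical mean of the log-likelihood. -/
noncomputable def meanLogLik (X : ℕ → Ω → ℝ × ℝ × ℝ × ℝ) (n : ℕ) (ω : Ω) (t : ℝ × (ℝ → ℝ)) : ℝ :=
  (∑ i ∈ Finset.range n, logLik t.1 t.2 (X i ω)) / n

/-! ### Law of large numbers -/

section LLN

variable {Ω₀ : Type*} [MeasurableSpace Ω₀] [StandardBorelSpace Ω₀] {P : Measure Ω₀}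
  [IsProbabilityMeasure P] {Y C W Z : Ω₀ → ℝ} {θ₀ : ℝ} {k₀ : ℝ → ℝ} {lc uc : ℝ} {K : Set ℝ}
  {a b : ℝ} [MeasurableSpace Ω] {μ : Measure Ω}
  {X : ℕ → Ω → ℝ × ℝ × ℝ × ℝ}

theorem IsModel.sample_mem (h : IsModel P Y C W Z θ₀ k₀ lc uc K a b) (hK : IsCompact K)
    (hident : ∀ i, IdentDistrib (X i) (observation Y C W Z) μ P) :
    ∀ᵐ ω ∂μ, ∀ i, X i ω ∈ obsSpace lc uc K a b :=
  ae_all_iff.2 fun i => (hident i).symm.ae_mem_snd (measurableSet_obsSpace hK) h.observation_mem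

/-- The law of large numbers for the log-likelihood. -/
theorem IsModel.tendstoInMeasure_meanLogLik [IsProbabilityMeasure μ]
    (h : IsModel P Y C W Z θ₀ k₀ lc uc K a b)
    (hab : a < b) (hK : IsCompact K) (hindep : iIndepFun X μ)
    (hident : ∀ i, IdentDistrib (X i) (observation Y C W Z) μ P) {M : ℝ} (t : ℝ × (ℝ → ℝ))
    (ht : t.2 ∈ nuisanceClass a b M) :
    TendstoInMeasure μ (fun n ω => meanLogLik X n ω t) atTop
      (fun _ => ∫ ω, logLik t.1 t.2 (observation Y C W Z ω) ∂P) := by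
  obtain ⟨θ, k⟩ := t
  obtain ⟨k', hk', hkk'⟩ := exists_continuous_eqOn hab ht
  have hm := measurable_logLik θ hk'
  have hid : ∀ i, IdentDistrib (logLik θ k' ∘ X i) (logLik θ k' ∘ observation Y C W Z) μ P :=
    fun i => (hident i).comp hm
  have heq : logLik θ k' ∘ observation Y C W Z =ᵐ[P] fun ω => logLik θ k (observation Y C W Z ω) :=
    h.observation_mem.mono fun ω hω => logLik_congr hkk' hω
  have hslln := strong_law_ae_real (fun i => logLik θ k' ∘ X i)
    ((hid 0).integrable_iff.2 ((h.integrable_logLik hab hK θ ht).congr heq.symm))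
    (fun i j hij => (hindep.indepFun hij).comp hm hm)
    (fun i => (hid i).trans (hid 0).symm)
  rw [(hid 0).integral_eq, integral_congr_ae heq] at hslln
  have hX := h.sample_mem hK hident
  refine TendstoInMeasure.congr_left (f := fun (n : ℕ) ω =>
      (∑ i ∈ Finset.range n, (logLik θ k' ∘ X i) ω) / n) (fun n => ?_)
    (tendstoInMeasure_of_tendsto_ae (fun n => ?_) hslln)
  · filter_upwards [hX] with ω hω
    simp only [meanLogLik]
    congr 1
    exact Finset.sum_congr rfl fun i _ => logLik_congr hkk' (hω i)
  · refine AEMeasurable.aestronglyMeasurable (AEMeasurable.div_const ?_ _)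
    exact Finset.aemeasurable_fun_sum _ fun i _ => (hid i).aemeasurable_fst

end LLN

end PartlyLinear

/-! ### Consistency -/

theorem lemma6 {Ω Ω₀ : Type*}
    -- the latent and observed variables of a single subject
    [MeasurableSpace Ω₀] [StandardBorelSpace Ω₀] (P : Measure Ω₀) [IsProbabilityMeasure P]
    (Y C W Z : Ω₀ → ℝ) (θ₀ : ℝ) (k₀ : ℝ → ℝ)
    (lc uc : ℝ) (K : Set ℝ) (hK : IsCompact K) (a b : ℝ) (hab : a < b)
    (hmodel : PartlyLinear.IsModel P Y C W Z θ₀ k₀ lc uc K a b)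
    -- the parameter spaces for `θ` and `k`, the latter with or without centring `E k(Z) = 0`
    (Θ : Set ℝ) (hΘ : IsCompact Θ) (hθ₀ : θ₀ ∈ Θ) (M : ℝ) (H : Set (ℝ → ℝ))
    (hH : H = PartlyLinear.nuisanceClass a b M ∨
      H = {k ∈ PartlyLinear.nuisanceClass a b M | ∫ ω, k (Z ω) ∂P = 0})
    (hk₀ : k₀ ∈ H)
    -- the i.i.d. sample
    [MeasurableSpace Ω] (μ : Measure Ω) [IsProbabilityMeasure μ]
    (X : ℕ → Ω → ℝ × ℝ × ℝ × ℝ) (hindep : iIndepFun X μ)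
    (hident : ∀ i, IdentDistrib (X i) (PartlyLinear.observation Y C W Z) μ P)
    -- the maximum likelihood estimator of `θ`
    (θhat : ℕ → Ω → ℝ) (hθhat : ∀ n, ∀ᵐ ω ∂μ, PartlyLinear.IsProfileMLE Θ H X n ω (θhat n ω))
    -- an arbitrary sequence of random elements of `Θ`
    (θt : ℕ → Ω → ℝ) (hθt : ∀ n ω, θt n ω ∈ Θ)
    (hΔ : TendstoInMeasure μ
      (fun n ω => PartlyLinear.profileDelta H X n ω (θhat n ω) (θt n ω)) atTop (fun _ => 0)) :
    TendstoInMeasure μ θt atTop (fun _ => θ₀) := by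
  open PartlyLinear in
  classical
  have hHs : H ⊆ nuisanceClass a b M := by
    rcases hH with rfl | rfl
    · exact subset_rfl
    · exact fun k hk => hk.1
  obtain ⟨c, hc, hsep⟩ := hmodel.exists_integral_logLik_le hab hK (hHs hk₀) hΘ hθ₀
  set m : ℝ × (ℝ → ℝ) → ℝ := fun t => ∫ ω, logLik t.1 t.2 (observation Y C W Z ω) ∂P with hm
  rw [tendstoInMeasure_iff_dist] at hΔ ⊢
  intro ε hε
  -- The separation at distance ε is 8η. The upper bound at θ spends 3η of it and the lower bound at
  -- the maximizer η, leaving 4η, more than the η allowed to `profileDelta`.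
  set η := c * ε ^ 2 / 8
  have hη : 0 < η := by positivity
  obtain ⟨T, hT, hTf, hTc⟩ := exists_finite_cover hab hHs hΘ hK lc uc hη
  set S := insert (θ₀, k₀) hTf.toFinset with hS
  have hlln : ∀ t ∈ S, Tendsto (fun n => μ {ω | η ≤ dist (meanLogLik X n ω t) (m t)})
      atTop (𝓝 0) := fun t ht => by
    refine tendstoInMeasure_iff_dist.1
      (hmodel.tendstoInMeasure_meanLogLik hab hK hindep hident (M := M) t ?_) η hη
    rcases Finset.mem_insert.1 ht with rfl | ht
    · exact hHs hk₀
    · exact hHs (hT (hTf.mem_toFinset.1 ht)).2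
  have hlim := (hΔ η hη).add (tendsto_finsetSum S hlln)
  rw [Finset.sum_const_zero, add_zero] at hlim
  refine tendsto_of_tendsto_of_tendsto_of_le_of_le' tendsto_const_nhds hlim
    (Eventually.of_forall fun _ => zero_le) ((eventually_gt_atTop 0).mono fun n hn => ?_)
  -- Monotonicity and subadditivity hold for arbitrary sets, so the estimators need not be
  -- measurable.
  refine le_trans (measure_mono_ae ?_) ((measure_union_le _ _).trans
    (add_le_add_right (measure_biUnion_finset_le S
      fun t => {ω | η ≤ dist (meanLogLik X n ω t) (m t)}) _))
  filter_upwards [hmodel.sample_mem hK hident, hθhat n] with ω hX hhat hfar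
  by_contra hcon
  have hcon : ¬ (ω ∈ {ω | η ≤ dist (profileDelta H X n ω (θhat n ω) (θt n ω)) 0} ∪
    ⋃ t ∈ S, {ω | η ≤ dist (meanLogLik X n ω t) (m t)}) := hcon
  simp only [mem_union, mem_iUnion, mem_ofPred_eq, not_or, not_exists, not_le, Real.dist_eq,
    sub_zero] at hcon
  obtain ⟨hD, hdev⟩ := hcon
  have hn' : (0 : ℝ) < n := Nat.cast_pos.2 hn
  set θ := θt n ω with hθ
  have hsq : c * ε ^ 2 ≤ c * (θ - θ₀) ^ 2 := by
    have : ε ≤ |θ - θ₀| := hfar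
    rw [← sq_abs (θ - θ₀)]
    gcongr
  -- The 3η lost are the net error in the sample, the deviation from the mean at a net point, and
  -- the net error in expectation.
  have hup : Real.log (profileLik H X n ω θ) ≤ (m (θ₀, k₀) - 5 * η) * n := by
    refine log_profileLik_le hX hk₀ fun k hk => ?_
    obtain ⟨t, ht, hclose⟩ := hTc θ (hθt n ω) k hk
    have h1 : ∑ i ∈ Finset.range n, logLik θ k (X i ω) ≤ (meanLogLik X n ω t + η) * n := by
      rw [add_mul, meanLogLik, div_mul_cancel₀ _ hn'.ne']
      calc _ ≤ ∑ i ∈ Finset.range n, (logLik t.1 t.2 (X i ω) + η) :=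
            Finset.sum_le_sum fun i _ => by linarith [(abs_le.1 (hclose _ (hX i))).2]
        _ = _ := by simp [Finset.sum_add_distrib, mul_comm]
    have h2 := (abs_lt.1 (hdev t (Finset.mem_insert_of_mem (hTf.mem_toFinset.2 ht)))).2
    have h3 : m t ≤ m (θ, k) + η := by
      have i1 := hmodel.integrable_logLik hab hK t.1 (hHs (hT ht).2)
      have i2 := hmodel.integrable_logLik hab hK θ (hHs hk)
      calc m t ≤ ∫ ω, (logLik θ k (observation Y C W Z ω) + η) ∂P := by
            refine integral_mono_ae i1 (i2.add (integrable_const η)) ?_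
            filter_upwards [hmodel.observation_mem] with ω' hω'
            linarith [(abs_le.1 (hclose _ hω')).1]
        _ = _ := by
            rw [integral_add i2 (integrable_const η)]
            simp [hm]
    have h4 : m (θ, k) ≤ m (θ₀, k₀) - c * (θ - θ₀) ^ 2 := hsep θ (hθt n ω) k (hHs hk)
    refine h1.trans (mul_le_mul_of_nonneg_right ?_ hn'.le)
    have : c * ε ^ 2 = 8 * η := by ring
    linarith
  have hlow : (m (θ₀, k₀) - η) * n ≤ Real.log (profileLik H X n ω (θhat n ω)) := by
    refine le_trans ?_ (hhat.log_le hθ₀ hX hk₀)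
    have h1 := (abs_lt.1 (hdev (θ₀, k₀) (Finset.mem_insert_self _ _))).1
    have h2 : ∑ i ∈ Finset.range n, logLik θ₀ k₀ (X i ω) = meanLogLik X n ω (θ₀, k₀) * n := by
      rw [meanLogLik, div_mul_cancel₀ _ hn'.ne']
    rw [h2]
    exact mul_le_mul_of_nonneg_right (by linarith) hn'.le
  have hD' : profileDelta H X n ω (θhat n ω) θ ≤ -(4 * η) := by
    rw [profileDelta, inv_mul_le_iff₀ hn']
    linarith
  linarith [(abs_lt.1 hD).1]
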